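/- **Theorem (LOCC Haar indistinguishability).** For $n\ge 0$ let $\mathcal H_n$ be the Haar distribution on $n$-qubit pure states, i.e. the unitarily invariant probability measure on the unit sphere of $(\mathbb C^2)^{\otimes n}\cong\mathbb C^{2^n}$. For integers $n,t\ge 0$ define the bipartite density matrices $$\rho_{AB}^{(n,t)} := \mathbb E_{|\psi\rangle\leftarrow\mathcal H_n}\Big[\,|\psi\rangle\langle\psi|^{\otimes t}_{A}\otimes|\psi\rangle\langle\psi|^{\otimes t}_{B}\Big],\qquad \sigma_{AB}^{(n,t)} := \mathbb E_{|\psi\rangle\leftarrow\mathcal H_n}\Big[\,|\psi\rangle\langle\psi|^{\otimes t}_{A}\Big]\otimes\mathbb E_{|\phi\rangle\leftarrow\mathcal H_n}\Big[\,|\phi\rangle\langle\phi|^{\otimes t}_{B}\Big].$$ An LOCC adversary $(A,B)$ is a finite two-party protocol without shared entanglement, in which Alice initially holds register $A$ and Bob register $B$: in each step one of the parties applies a quantum instrument with finitely many classical outcomes to its own register (possibly changing the register to another finite-dimensional one) and announces the outcome to the other party; who acts next and what is done may depend on all previous outcomes; at the end Bob performs a two-outcome measurement and outputs a bit. The parties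 are computationally unbounded. Then $\rho_{AB}^{(n,t)}$ and $\sigma_{AB}^{(n,t)}$ are $O(t^2/2^n)$-LOCC indistinguishable: there is an absolute constant $C>0$ such that for all integers $n,t\ge 0$ and every LOCC adversary $(A,B)$, $$\Big|\Pr\big[(A,B)(\rho_{AB}^{(n,t)})=1\big]-\Pr\big[(A,B)(\sigma_{AB}^{(n,t)})=1\big]\Big|\le C\cdot\frac{t^2}{2^n}.$$ -/

import Mathlib

noncomputable section

namespace LOCCHaar

open MeasureTheory Matrix
open scoped Kronecker ComplexOrder

/-- Labels of the computational basis of `n` qubits, that is, `n`-bit strings. -/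
abbrev Bits (n : ℕ) : Type := Fin n → Fin 2

/-- Pure `n`-qubit states: unit vectors of `ℂ^(2^n)`. -/
abbrev PureState (n : ℕ) : Type :=
  Metric.sphere (0 : EuclideanSpace ℂ (Bits n)) 1

/-- The Haar distribution on `n`-qubit pure states: the normalized rotation-invariant surface
measure on the unit sphere of `ℂ^(2^n)`. -/
def haarState (n : ℕ) : Measure (PureState n) :=
  ((volume : Measure (EuclideanSpace ℂ (Bits n))).toSphere Set.univ)⁻¹ •
    (volume : Measure (EuclideanSpace ℂ (Bits n))).toSphere

instance (n : ℕ) : IsProbabilityMeasure (haarState n) := by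
  refine ⟨?_⟩
  have h0 : (volume : Measure (EuclideanSpace ℂ (Bits n))).toSphere Set.univ ≠ 0 := by
    rw [Ne, Measure.measure_univ_eq_zero]
    exact Measure.toSphere_ne_zero _
  rw [haarState, Measure.smul_apply, smul_eq_mul]
  exact ENNReal.inv_mul_cancel h0 (measure_ne_top _ _)

open scoped Pointwise in
/-- The Haar distribution is invariant under all unitary maps. -/
theorem map_haarState (n : ℕ)
    (U : EuclideanSpace ℂ (Bits n) ≃ₗᵢ[ℂ] EuclideanSpace ℂ (Bits n)) :
    (haarState n).map (fun ψ : PureState n => (⟨U ψ.1, by simp⟩ : PureState n)) = haarState n := by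
  have hm : Measurable (fun ψ : PureState n => (⟨U ψ.1, by simp⟩ : PureState n)) :=
    (Continuous.subtype_mk (U.continuous.comp continuous_subtype_val) _).measurable
  have hU : MeasurePreserving (U : EuclideanSpace ℂ (Bits n) → _) volume volume :=
    LinearIsometryEquiv.measurePreserving
      ({ toLinearEquiv := U.toLinearEquiv.restrictScalars ℝ, norm_map' := U.norm_map } :
        EuclideanSpace ℂ (Bits n) ≃ₗᵢ[ℝ] EuclideanSpace ℂ (Bits n))
  ext s hs
  rw [Measure.map_apply hm hs, haarState, Measure.smul_apply, Measure.smul_apply,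
    Measure.toSphere_apply' _ hs, Measure.toSphere_apply' _ (hm hs)]
  congr 2
  symm
  rw [← hU.measure_preimage_emb U.toHomeomorph.measurableEmbedding]
  congr 1
  ext x
  simp only [Set.mem_smul, Set.mem_image, Set.mem_preimage]
  constructor
  · rintro ⟨r, hr, y, ⟨ψ, hψ, rfl⟩, h⟩
    refine ⟨r, hr, U.symm ψ.1, ⟨⟨U.symm ψ.1, by simp⟩, by simpa using hψ, rfl⟩, ?_⟩
    apply U.injective
    rw [← h]
    exact (U.toLinearEquiv.map_smul_of_tower r _).trans
      (congrArg (r • ·) (U.apply_symm_apply ψ.1))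
  · rintro ⟨r, hr, y, ⟨ψ, hψ, rfl⟩, rfl⟩
    exact ⟨r, hr, _, ⟨_, hψ, rfl⟩, (U.toLinearEquiv.map_smul_of_tower r ψ.1).symm⟩

/-- The density matrix `|ψ⟩⟨ψ|` of a pure state. -/
def ketbra {n : ℕ} (ψ : PureState n) : Matrix (Bits n) (Bits n) ℂ :=
  vecMulVec (fun x => ψ.1 x) (star fun x => ψ.1 x)

/-- The tensor power `M^{⊗t}`, in the product basis of `t` registers. -/
def tensorPow {ι : Type} (t : ℕ) (M : Matrix ι ι ℂ) : Matrix (Fin t → ι) (Fin t → ι) ℂ :=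
  of fun x y => ∏ i, M (x i) (y i)

/-- Entrywise expectation of a random matrix. -/
def matrixExp {Ω κ : Type} [MeasurableSpace Ω] (μ : Measure Ω) (F : Ω → Matrix κ κ ℂ) :
    Matrix κ κ ℂ :=
  of fun x y => ∫ ω, F ω x y ∂μ

/-- A register holding `t` blocks of `n` qubits each. -/
abbrev Reg (n t : ℕ) : Type := Fin t → Bits n

/-- `ρ_AB = E_ψ [ |ψ⟩⟨ψ|^{⊗t}_A ⊗ |ψ⟩⟨ψ|^{⊗t}_B ]`: `t` copies each of the same Haar state. -/
def identicalHaar (n t : ℕ) : Matrix (Reg n t × Reg n t) (Reg n t × Reg n t) ℂ :=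
  matrixExp (haarState n) fun ψ => tensorPow t (ketbra ψ) ⊗ₖ tensorPow t (ketbra ψ)

/-- `σ_AB = E_ψ [ |ψ⟩⟨ψ|^{⊗t}_A ] ⊗ E_φ [ |φ⟩⟨φ|^{⊗t}_B ]`: `t` copies each of two independent
Haar states. -/
def independentHaar (n t : ℕ) : Matrix (Reg n t × Reg n t) (Reg n t × Reg n t) ℂ :=
  matrixExp (haarState n) (fun ψ => tensorPow t (ketbra ψ)) ⊗ₖ
    matrixExp (haarState n) (fun φ => tensorPow t (ketbra φ))

/-- A quantum instrument from a register with basis `α` to a register with basis `α'` with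
classical outcomes in `ι`, in Kraus form: on outcome `m` the (unnormalized) state becomes
`∑ j, K_{m,j} X K_{m,j}†`, and the sum over all outcomes is trace preserving.
The index `j` is not observed, so these are all the instruments with outcomes in `ι`. -/
structure Instrument (ι α α' : Type) [Fintype ι] [Fintype α] [DecidableEq α] [Fintype α'] where
  /-- number of Kraus operators for each outcome (some may be zero) -/
  numKraus : ℕ
  /-- the Kraus operators -/
  kraus : ι → Fin numKraus → Matrix α' α ℂ
  complete : ∑ m, ∑ j, (kraus m j)ᴴ * kraus m j = 1

/-- Finite two-party protocols with local operations and classical communication. `LOCC α β` is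
the type of (remaining) protocols when Alice holds a register with basis `α` and Bob one with
basis `β`. A protocol is a finite tree: at a node one party applies an instrument to its own
register, possibly changing it (adding an ancilla, discarding part of it, keeping private
memory), and announces the outcome, on which everything that follows may depend. At a leaf, Bob
measures `{E, 1 - E}` and outputs `1` on the outcome `E`. -/
inductive LOCC : (α β : Type) → [Fintype α] → [DecidableEq α] → [Fintype β] → [DecidableEq β] →
    Type 1
  | output {α β : Type} [Fintype α] [DecidableEq α] [Fintype β] [DecidableEq β]
      (E : Matrix β β ℂ) (nonneg : E.PosSemidef) (le_one : (1 - E).PosSemidef) : LOCC α β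
  | alice {α β α' ι : Type} [Fintype α] [DecidableEq α] [Fintype β] [DecidableEq β]
      [Fintype α'] [DecidableEq α'] [Fintype ι]
      (I : Instrument ι α α') (next : ι → LOCC α' β) : LOCC α β
  | bob {α β β' ι : Type} [Fintype α] [DecidableEq α] [Fintype β] [DecidableEq β]
      [Fintype β'] [DecidableEq β'] [Fintype ι]
      (I : Instrument ι β β') (next : ι → LOCC α β') : LOCC α β

/-- The unnormalized joint state after Alice's instrument gave outcome `m`. -/
def Instrument.onAlice {ι α α' β : Type} [Fintype ι] [Fintype α] [DecidableEq α] [Fintype α']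
    [Fintype β] [DecidableEq β] (I : Instrument ι α α') (m : ι)
    (ρ : Matrix (α × β) (α × β) ℂ) : Matrix (α' × β) (α' × β) ℂ :=
  ∑ j, (I.kraus m j ⊗ₖ (1 : Matrix β β ℂ)) * ρ * (I.kraus m j ⊗ₖ (1 : Matrix β β ℂ))ᴴ

/-- The unnormalized joint state after Bob's instrument gave outcome `m`. -/
def Instrument.onBob {ι α β β' : Type} [Fintype ι] [Fintype β] [DecidableEq β] [Fintype β']
    [Fintype α] [DecidableEq α] (I : Instrument ι β β') (m : ι)
    (ρ : Matrix (α × β) (α × β) ℂ) : Matrix (α × β') (α × β') ℂ :=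
  ∑ j, ((1 : Matrix α α ℂ) ⊗ₖ I.kraus m j) * ρ * ((1 : Matrix α α ℂ) ⊗ₖ I.kraus m j)ᴴ

/-- `Pr[(A,B)(ρ) = 1]`. As states along the tree are unnormalized (their trace is the probability
of the transcript), the probability is the sum over all transcripts of `Tr((1 ⊗ E) ρ)`. -/
def LOCC.prob : {α β : Type} → [Fintype α] → [DecidableEq α] → [Fintype β] → [DecidableEq β] →
    LOCC α β → Matrix (α × β) (α × β) ℂ → ℝ
  | _, _, _, _, _, _, @LOCC.output α _ _ _ _ _ E _ _, ρ =>
    (((1 : Matrix α α ℂ) ⊗ₖ E) * ρ).trace.re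
  | _, _, _, _, _, _, @LOCC.alice _ _ _ _ _ _ _ _ _ _ _ I next, ρ =>
    ∑ m, (next m).prob (I.onAlice m ρ)
  | _, _, _, _, _, _, @LOCC.bob _ _ _ _ _ _ _ _ _ _ _ I next, ρ =>
    ∑ m, (next m).prob (I.onBob m ρ)

/-- `ε`-LOCC indistinguishability of two bipartite states. -/
def LOCCIndistinguishable {α β : Type} [Fintype α] [DecidableEq α] [Fintype β] [DecidableEq β]
    (ε : ℝ) (ρ σ : Matrix (α × β) (α × β) ℂ) : Prop :=
  ∀ P : LOCC α β, |P.prob ρ - P.prob σ| ≤ ε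

end LOCCHaar

end

/-!
Put `d = 2 ^ n`. The entries of `ρ` and `σ` are given by the Haar moments
`E (z ^ α * conj z ^ β) = α! / (d * (d + 1) * ⋯ * (d + |α| - 1))` if `α = β` and `0` otherwise: they
are the Gaussian moments divided by the moment of order `2 * |α|` of the Gaussian radius. Hence the
partial transpose of `ρ` is `1 / (d * ⋯ * (d + 2 * t - 1))` times the Gaussian Gram matrix of the
functions `z ^ a * conj z ^ b` with `|a| = |b| = t`. Expanding these in Wick (complex Hermite)
polynomials, which are orthogonal, writes the Gram matrix as a sum of positive semidefinite
matrices of rank one. The terms of top degree do not involve contractions between `z` and `conj z`,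
so their sum, times `1 / (d * ⋯ * (d + t - 1)) ^ 2`, is the partial transpose of `σ`. Comparing the
two weights, `ρ - (1 - t ^ 2 / d) • σ` has positive semidefinite partial transpose. Local
operations preserve this property and the outcome probabilities of such an operator are
nonnegative, so each output bit has, on `ρ`, at least `1 - t ^ 2 / d` times its probability on `σ`.
-/

noncomputable section

namespace LOCCHaar

section PartialTranspose

open Matrix
open scoped Kronecker

variable {R α α' β β' γ : Type*}

/-- The partial transpose of a bipartite matrix, taken on the second (Bob's) tensor factor. -/
def partialTranspose (D : Matrix (α × β) (α' × β') R) : Matrix (α × β') (α' × β) R :=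
  of fun x y => D (x.1, y.2) (y.1, x.2)

@[simp]
theorem partialTranspose_apply (D : Matrix (α × β) (α' × β') R) (x : α × β') (y : α' × β) :
    partialTranspose D x y = D (x.1, y.2) (y.1, x.2) :=
  rfl

theorem partialTranspose_sum {ι : Type*} [AddCommMonoid R] (s : Finset ι)
    (D : ι → Matrix (α × β) (α' × β') R) :
    partialTranspose (∑ i ∈ s, D i) = ∑ i ∈ s, partialTranspose (D i) := by
  ext x y
  simp [Matrix.sum_apply]

theorem partialTranspose_sub_smul {S : Type*} [AddGroup R] [SMul S R] (c : S)
    (D D' : Matrix (α × β) (α' × β') R) :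
    partialTranspose (D - c • D') = partialTranspose D - c • partialTranspose D' :=
  rfl

theorem trace_kronecker_mul_partialTranspose [CommSemiring R] [Fintype α] [Fintype β]
    (A : Matrix α α R) (B : Matrix β β R) (D : Matrix (α × β) (α × β) R) :
    ((A ⊗ₖ Bᵀ) * partialTranspose D).trace = ((A ⊗ₖ B) * D).trace := by
  simp only [trace, diag_apply, mul_apply, kroneckerMap_apply, transpose_apply,
    partialTranspose_apply, Fintype.sum_prod_type]
  refine Finset.sum_congr rfl fun a _ => ?_
  conv_lhs => rw [Finset.sum_comm]
  conv_rhs => rw [Finset.sum_comm]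
  refine Finset.sum_congr rfl fun a' _ => ?_
  exact Finset.sum_comm

theorem partialTranspose_conj_kronecker_one [CommSemiring R] [StarRing R] [Fintype α] [Fintype β]
    [DecidableEq β] (K : Matrix γ α R) (D : Matrix (α × β) (α × β) R) :
    partialTranspose ((K ⊗ₖ (1 : Matrix β β R)) * D * (K ⊗ₖ (1 : Matrix β β R))ᴴ) =
      (K ⊗ₖ (1 : Matrix β β R)) * partialTranspose D * (K ⊗ₖ (1 : Matrix β β R))ᴴ := by
  ext ⟨a, b⟩ ⟨a', b'⟩
  simp [mul_apply, Fintype.sum_prod_type, one_apply, apply_ite star]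

theorem partialTranspose_conj_one_kronecker [CommSemiring R] [StarRing R] [Fintype α] [Fintype β]
    [DecidableEq α] (K : Matrix γ β R) (D : Matrix (α × β) (α × β) R) :
    partialTranspose (((1 : Matrix α α R) ⊗ₖ K) * D * ((1 : Matrix α α R) ⊗ₖ K)ᴴ) =
      ((1 : Matrix α α R) ⊗ₖ K.map star) * partialTranspose D *
        ((1 : Matrix α α R) ⊗ₖ K.map star)ᴴ := by
  ext ⟨a, b⟩ ⟨a', b'⟩
  simp only [partialTranspose_apply, mul_apply, Fintype.sum_prod_type, kroneckerMap_apply,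
    one_apply, conjTranspose_apply, map_apply, apply_ite star, ite_mul, one_mul, zero_mul,
    Finset.sum_mul, star_zero, star_star, mul_ite, mul_zero, Finset.sum_ite_irrel,
    Finset.sum_const_zero, Finset.sum_ite_eq, Finset.mem_univ, if_true]
  rw [Finset.sum_comm]
  refine Finset.sum_congr rfl fun c _ => Finset.sum_congr rfl fun c' _ => ?_
  ring

end PartialTranspose

section Protocols

open Matrix
open scoped Kronecker ComplexOrder MatrixOrder

theorem trace_mul_nonneg_of_posSemidef {𝕜 m : Type*} [RCLike 𝕜] [Fintype m]
    {A B : Matrix m m 𝕜} (hA : A.PosSemidef) (hB : B.PosSemidef) : 0 ≤ (A * B).trace := by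
  classical
  obtain ⟨C, rfl⟩ := CStarAlgebra.nonneg_iff_eq_star_mul_self.mp hA.nonneg
  rw [trace_mul_cycle, ← trace_mul_comm, ← Matrix.mul_assoc]
  exact (hB.mul_mul_conjTranspose_same C).trace_nonneg

theorem trace_sum_mul_mul_conjTranspose {R κ m n : Type*} [CommSemiring R] [StarRing R]
    [Fintype m] [Fintype n] (s : Finset κ) (K : κ → Matrix m n R) (D : Matrix n n R) :
    (∑ k ∈ s, K k * D * (K k)ᴴ).trace = ((∑ k ∈ s, (K k)ᴴ * K k) * D).trace := by
  rw [trace_sum, Matrix.sum_mul, trace_sum]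
  exact Finset.sum_congr rfl fun k _ => trace_mul_cycle _ _ _

/-- A bipartite matrix has positive partial transpose (PPT): the property, preserved by local
operations, that makes all outcome probabilities of LOCC protocols nonnegative. The matrix itself is
not required to be positive semidefinite. -/
def IsPPT {α β : Type*} (D : Matrix (α × β) (α × β) ℂ) : Prop :=
  (partialTranspose D).PosSemidef

theorem IsPPT.trace_one_kronecker_mul_nonneg {α β : Type*} [Fintype α] [DecidableEq α] [Fintype β]
    {D : Matrix (α × β) (α × β) ℂ} (hD : IsPPT D) {E : Matrix β β ℂ} (hE : E.PosSemidef) :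
    0 ≤ (((1 : Matrix α α ℂ) ⊗ₖ E) * D).trace := by
  rw [← trace_kronecker_mul_partialTranspose]
  exact trace_mul_nonneg_of_posSemidef (PosSemidef.one.kronecker hE.transpose) hD

variable {ι α α' β β' : Type} [Fintype ι] [Fintype α] [DecidableEq α] [Fintype α'] [Fintype β]
  [DecidableEq β] [Fintype β']

theorem IsPPT.onAlice {D : Matrix (α × β) (α × β) ℂ} (hD : IsPPT D) (I : Instrument ι α α')
    (m : ι) : IsPPT (I.onAlice m D) := by
  rw [IsPPT, Instrument.onAlice, partialTranspose_sum]
  refine posSemidef_sum _ fun j _ => ?_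
  rw [partialTranspose_conj_kronecker_one]
  exact hD.mul_mul_conjTranspose_same _

theorem IsPPT.onBob {D : Matrix (α × β) (α × β) ℂ} (hD : IsPPT D) (I : Instrument ι β β')
    (m : ι) : IsPPT (I.onBob m D) := by
  rw [IsPPT, Instrument.onBob, partialTranspose_sum]
  refine posSemidef_sum _ fun j _ => ?_
  rw [partialTranspose_conj_one_kronecker]
  exact hD.mul_mul_conjTranspose_same _

theorem Instrument.sum_trace_onAlice (I : Instrument ι α α') (D : Matrix (α × β) (α × β) ℂ) :
    ∑ m, (I.onAlice m D).trace = D.trace := by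
  have hcomplete : ∑ m, ∑ j, (I.kraus m j ⊗ₖ (1 : Matrix β β ℂ))ᴴ *
      (I.kraus m j ⊗ₖ (1 : Matrix β β ℂ)) = 1 := by
    simp only [conjTranspose_kronecker, ← mul_kronecker_mul, conjTranspose_one, Matrix.one_mul]
    rw [← one_kronecker_one, ← I.complete]
    ext ⟨a, b⟩ ⟨a', b'⟩
    simp [Matrix.sum_apply, Finset.sum_mul]
  simp_rw [Instrument.onAlice, trace_sum_mul_mul_conjTranspose, ← trace_sum, ← Matrix.sum_mul,
    hcomplete, Matrix.one_mul]

theorem Instrument.sum_trace_onBob (I : Instrument ι β β') (D : Matrix (α × β) (α × β) ℂ) :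
    ∑ m, (I.onBob m D).trace = D.trace := by
  have hcomplete : ∑ m, ∑ j, ((1 : Matrix α α ℂ) ⊗ₖ I.kraus m j)ᴴ *
      ((1 : Matrix α α ℂ) ⊗ₖ I.kraus m j) = 1 := by
    simp only [conjTranspose_kronecker, ← mul_kronecker_mul, conjTranspose_one, Matrix.one_mul]
    rw [← one_kronecker_one, ← I.complete]
    ext ⟨a, b⟩ ⟨a', b'⟩
    simp [Matrix.sum_apply, Finset.mul_sum]
  simp_rw [Instrument.onBob, trace_sum_mul_mul_conjTranspose, ← trace_sum, ← Matrix.sum_mul,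
    hcomplete, Matrix.one_mul]

theorem Instrument.onAlice_sub_smul (I : Instrument ι α α') (m : ι) (c : ℝ)
    (ρ σ : Matrix (α × β) (α × β) ℂ) :
    I.onAlice m (ρ - c • σ) = I.onAlice m ρ - c • I.onAlice m σ := by
  simp [Instrument.onAlice, Matrix.mul_sub, Matrix.sub_mul, Finset.smul_sum]

theorem Instrument.onBob_sub_smul (I : Instrument ι β β') (m : ι) (c : ℝ)
    (ρ σ : Matrix (α × β) (α × β) ℂ) :
    I.onBob m (ρ - c • σ) = I.onBob m ρ - c • I.onBob m σ := by
  simp [Instrument.onBob, Matrix.mul_sub, Matrix.sub_mul, Finset.smul_sum]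

theorem LOCC.prob_sub_smul : {α β : Type} → [Fintype α] → [DecidableEq α] → [Fintype β] →
    [DecidableEq β] → (P : LOCC α β) → (c : ℝ) → (ρ σ : Matrix (α × β) (α × β) ℂ) →
    P.prob (ρ - c • σ) = P.prob ρ - c * P.prob σ
  | _, _, _, _, _, _, @LOCC.output _ _ _ _ _ _ E _ _, c, ρ, σ => by
    simp [LOCC.prob, Matrix.mul_sub]
  | _, _, _, _, _, _, @LOCC.alice _ _ _ _ _ _ _ _ _ _ _ I next, c, ρ, σ => by
    simp only [LOCC.prob, I.onAlice_sub_smul, Finset.mul_sum, ← Finset.sum_sub_distrib]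
    exact Finset.sum_congr rfl fun m _ => (next m).prob_sub_smul c _ _
  | _, _, _, _, _, _, @LOCC.bob _ _ _ _ _ _ _ _ _ _ _ I next, c, ρ, σ => by
    simp only [LOCC.prob, I.onBob_sub_smul, Finset.mul_sum, ← Finset.sum_sub_distrib]
    exact Finset.sum_congr rfl fun m _ => (next m).prob_sub_smul c _ _

theorem LOCC.prob_mem_Icc : {α β : Type} → [Fintype α] → [DecidableEq α] → [Fintype β] →
    [DecidableEq β] → (P : LOCC α β) → {D : Matrix (α × β) (α × β) ℂ} → IsPPT D →
    P.prob D ∈ Set.Icc 0 D.trace.re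
  | α, _, _, _, _, _, @LOCC.output _ _ _ _ _ _ E nonneg le_one, D, hD => by
    have htrace : D.trace = (((1 : Matrix α α ℂ) ⊗ₖ E) * D).trace +
        (((1 : Matrix α α ℂ) ⊗ₖ (1 - E)) * D).trace := by
      rw [← trace_add, ← Matrix.add_mul, ← kronecker_add, add_sub_cancel, one_kronecker_one,
        Matrix.one_mul]
    have hE := (Complex.le_def.1 (hD.trace_one_kronecker_mul_nonneg nonneg)).1
    have hE' := (Complex.le_def.1 (hD.trace_one_kronecker_mul_nonneg le_one)).1
    rw [htrace, Complex.add_re]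
    exact ⟨hE, le_add_of_nonneg_right hE'⟩
  | _, _, _, _, _, _, @LOCC.alice _ _ _ _ _ _ _ _ _ _ _ I next, D, hD => by
    rw [← I.sum_trace_onAlice D, Complex.re_sum]
    exact ⟨Finset.sum_nonneg fun m _ => ((next m).prob_mem_Icc (hD.onAlice I m)).1,
      Finset.sum_le_sum fun m _ => ((next m).prob_mem_Icc (hD.onAlice I m)).2⟩
  | _, _, _, _, _, _, @LOCC.bob _ _ _ _ _ _ _ _ _ _ _ I next, D, hD => by
    rw [← I.sum_trace_onBob D, Complex.re_sum]
    exact ⟨Finset.sum_nonneg fun m _ => ((next m).prob_mem_Icc (hD.onBob I m)).1,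
      Finset.sum_le_sum fun m _ => ((next m).prob_mem_Icc (hD.onBob I m)).2⟩

theorem LOCCIndistinguishable.of_isPPT {ε : ℝ} (hε : 0 ≤ ε) {ρ σ : Matrix (α × β) (α × β) ℂ}
    (hρ : ρ.trace = 1) (hσ : σ.trace = 1) (hσ_ppt : IsPPT σ) (hsub : IsPPT (ρ - (1 - ε) • σ)) :
    LOCCIndistinguishable ε ρ σ := by
  intro P
  obtain ⟨hsub_nonneg, hsub_le⟩ := P.prob_mem_Icc hsub
  obtain ⟨hσ_nonneg, hσ_le⟩ := P.prob_mem_Icc hσ_ppt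
  simp only [LOCC.prob_sub_smul, trace_sub, trace_smul, hρ, hσ, Complex.sub_re, Complex.smul_re,
    Complex.one_re, smul_eq_mul, mul_one] at hsub_nonneg hsub_le hσ_le
  rw [abs_le]
  constructor <;> nlinarith

end Protocols

section Words

open Finset

variable {ι κ : Type*} [Fintype ι] [DecidableEq κ]

/-- The number of occurrences of each letter in a word `x`: the multi-index `α` for which
`∏ j, z (x j)` is the monomial `z ^ α`. -/
def occurrences (x : ι → κ) (i : κ) : ℕ := #{j | x j = i}

theorem occurrences_le_card (x : ι → κ) (i : κ) : occurrences x i ≤ Fintype.card ι :=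
  card_le_univ _

variable [Fintype κ]

theorem sum_occurrences (x : ι → κ) : ∑ i, occurrences x i = Fintype.card ι :=
  (card_eq_sum_card_fiberwise fun _ _ => mem_univ _).symm

theorem prod_comp_eq_prod_pow_occurrences {M : Type*} [CommMonoid M] (f : κ → M) (x : ι → κ) :
    ∏ j, f (x j) = ∏ i, f i ^ occurrences x i := by
  simp only [← prod_fiberwise' univ x f, prod_const, occurrences]

end Words

section WickExpansion

open Finset Matrix
open scoped Nat ComplexOrder

/-- The coefficient of the Wick (complex Hermite) polynomial `:z ^ m * conj z ^ n:` in the expansion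
of `z ^ a * conj z ^ b`. The condition `a + n = b + m` says `a - m = b - n`, which is the number of
contracted pairs. -/
def wickCoeff (a b m n : ℕ) : ℕ :=
  if a + n = b + m then a.choose m * b.choose n * (a - m)! else 0

@[simp]
theorem wickCoeff_self (a b : ℕ) : wickCoeff a b a b = 1 := by
  simp [wickCoeff, add_comm]

theorem wickCoeff_eq_zero_of_lt {a b m n : ℕ} (h : a < m) : wickCoeff a b m n = 0 := by
  simp [wickCoeff, Nat.choose_eq_zero_of_lt h]

theorem eq_of_wickCoeff_self_left_ne_zero {a b n : ℕ} (h : wickCoeff a b a n ≠ 0) : n = b := by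
  have := (ite_ne_right_iff.1 h).1
  omega

theorem factorial_mul_wickCoeff_mul_wickCoeff (m n k k' : ℕ) :
    m ! * n ! * (wickCoeff (m + k) (n + k) m n * wickCoeff (m + k') (n + k') m n) =
      (m + k)! * (n + k')! * ((m + k').choose m * (n + k).choose k) := by
  have hk : wickCoeff (m + k) (n + k) m n = (m + k).choose m * (n + k).choose k * k ! := by
    rw [wickCoeff, if_pos (by ring), ← Nat.choose_symm_add (a := n), Nat.add_sub_cancel_left]
  have hk' : wickCoeff (m + k') (n + k') m n = (m + k').choose m * (n + k').choose n * k' ! := by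
    rw [wickCoeff, if_pos (by ring), Nat.add_sub_cancel_left]
  have hm : (m + k).choose m * m ! * k ! = (m + k)! := by
    rw [Nat.choose_symm_add, Nat.add_choose_mul_factorial_mul_factorial]
  have hn : (n + k').choose n * n ! * k' ! = (n + k')! := by
    rw [Nat.choose_symm_add, Nat.add_choose_mul_factorial_mul_factorial]
  rw [hk, hk', ← hm, ← hn]
  ring

theorem sum_wickCoeff_mul_wickCoeff_right {N a b a' b' m : ℕ} (hb : b ≤ N)
    (h : a + b' = a' + b) (hm : m ≤ a) :
    ∑ n ∈ range (N + 1), m ! * n ! * (wickCoeff a b m n * wickCoeff a' b' m n) =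
      a ! * b' ! * (a'.choose m * b.choose (a - m)) := by
  by_cases hm' : a - m ≤ b ∧ m ≤ a'
  · obtain ⟨k, rfl⟩ := Nat.exists_eq_add_of_le hm
    obtain ⟨k', rfl⟩ := Nat.exists_eq_add_of_le hm'.2
    obtain ⟨n, rfl⟩ := Nat.exists_eq_add_of_le' (show k ≤ b by omega)
    obtain rfl : b' = n + k' := by omega
    rw [sum_eq_single_of_mem n (mem_range.2 (by omega)), factorial_mul_wickCoeff_mul_wickCoeff,
      Nat.add_sub_cancel_left]
    intro n' _ hne
    rw [wickCoeff, if_neg (by omega), zero_mul, mul_zero]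
  · have hright : a'.choose m * b.choose (a - m) = 0 := by
      rw [mul_eq_zero, Nat.choose_eq_zero_iff, Nat.choose_eq_zero_iff]
      omega
    rw [hright, mul_zero]
    refine sum_eq_zero fun n _ => ?_
    by_contra hne
    obtain ⟨hW, hW'⟩ := mul_ne_zero_iff.1 (mul_ne_zero_iff.1 hne).2
    have := (ite_ne_right_iff.1 hW).1
    have := mt wickCoeff_eq_zero_of_lt hW'
    omega

theorem sum_wickCoeff_mul_wickCoeff {N a b : ℕ} (ha : a ≤ N) (hb : b ≤ N) (a' b' : ℕ) :
    ∑ p ∈ range (N + 1) ×ˢ range (N + 1),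
        p.1 ! * p.2 ! * (wickCoeff a b p.1 p.2 * wickCoeff a' b' p.1 p.2) =
      if a + b' = a' + b then (a + b')! else 0 := by
  rw [sum_product]
  split_ifs with h
  · calc
      _ = ∑ m ∈ range (a + 1),
          ∑ n ∈ range (N + 1), m ! * n ! * (wickCoeff a b m n * wickCoeff a' b' m n) := by
        refine (sum_subset (range_subset_range.2 (by omega)) fun m _ hm =>
          sum_eq_zero fun n _ => ?_).symm
        rw [wickCoeff_eq_zero_of_lt (by simpa using hm), zero_mul, mul_zero]
      _ = ∑ m ∈ range (a + 1), a ! * b' ! * (a'.choose m * b.choose (a - m)) :=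
        sum_congr rfl fun m hm =>
          sum_wickCoeff_mul_wickCoeff_right hb h (mem_range_succ_iff.1 hm)
      _ = a ! * b' ! * (a' + b).choose a := by
        rw [← mul_sum, Nat.add_choose_eq, Nat.sum_antidiagonal_eq_sum_range_succ_mk]
      _ = (a + b')! := by
        rw [← h, add_comm a b', ← Nat.add_choose_mul_factorial_mul_factorial b' a]
        ring
  · refine sum_eq_zero fun m _ => sum_eq_zero fun n _ => ?_
    simp only [wickCoeff]
    split_ifs
    · omega
    all_goals simp only [zero_mul, mul_zero]

variable {κ : Type*} [Fintype κ]

/-- The product of `wickCoeff` over the coordinates, `p i` being the pair of exponents of the Wick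
polynomial in the `i`-th coordinate. -/
def multiWickCoeff (α β : κ → ℕ) (p : κ → ℕ × ℕ) : ℕ :=
  ∏ i, wickCoeff (α i) (β i) (p i).1 (p i).2

/-- The squared Gaussian norm of the Wick polynomial with exponents `p`. -/
def wickNormSq (p : κ → ℕ × ℕ) : ℕ :=
  ∏ i, (p i).1 ! * (p i).2 !

variable (κ) in
/-- The pairs of multi-indices with all entries at most `N`: the exponents of all Wick polynomials
that can occur in `z ^ α * conj z ^ β` when `α` and `β` have entries at most `N`. -/
def wickBox [DecidableEq κ] (N : ℕ) : Finset (κ → ℕ × ℕ) :=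
  Fintype.piFinset fun _ => range (N + 1) ×ˢ range (N + 1)

theorem sum_multiWickCoeff_mul_multiWickCoeff [DecidableEq κ] {N : ℕ} {α β : κ → ℕ}
    (hα : ∀ i, α i ≤ N) (hβ : ∀ i, β i ≤ N) (α' β' : κ → ℕ) :
    ∑ p ∈ wickBox κ N, wickNormSq p * (multiWickCoeff α β p * multiWickCoeff α' β' p) =
      if α + β' = α' + β then ∏ i, (α i + β' i)! else 0 := by
  simp only [wickBox, wickNormSq, multiWickCoeff, ← prod_mul_distrib]
  rw [sum_prod_piFinset _ fun i (q : ℕ × ℕ) =>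
    q.1 ! * q.2 ! * (wickCoeff (α i) (β i) q.1 q.2 * wickCoeff (α' i) (β' i) q.1 q.2)]
  simp only [sum_wickCoeff_mul_wickCoeff (hα _) (hβ _), prod_ite_zero, mem_univ, true_imp_iff,
    funext_iff, Pi.add_apply]

theorem multiWickCoeff_self (α β : κ → ℕ) : multiWickCoeff α β (fun i => (α i, β i)) = 1 := by
  simp [multiWickCoeff]

theorem eq_of_multiWickCoeff_ne_zero {α β : κ → ℕ} {p : κ → ℕ × ℕ}
    (hp : ∑ i, (p i).1 = ∑ i, α i) (h : multiWickCoeff α β p ≠ 0) : p = fun i => (α i, β i) := by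
  have hcoeff (i : κ) : wickCoeff (α i) (β i) (p i).1 (p i).2 ≠ 0 :=
    prod_ne_zero_iff.1 h i (mem_univ i)
  have hle (i : κ) : (p i).1 ≤ α i := not_lt.1 (mt wickCoeff_eq_zero_of_lt (hcoeff i))
  have hfst := (sum_eq_sum_iff_of_le fun i _ => hle i).1 hp
  funext i
  have hi := hfst i (mem_univ i)
  exact Prod.ext hi (eq_of_wickCoeff_self_left_ne_zero (hi ▸ hcoeff i))

theorem sum_topDegree_multiWickCoeff_mul_multiWickCoeff [DecidableEq κ] {N : ℕ}
    {α β α' β' : κ → ℕ} (hα : ∀ i, α i ≤ N) (hβ : ∀ i, β i ≤ N)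
    (hsum : ∑ i, α' i = ∑ i, α i) :
    ∑ p ∈ wickBox κ N with ∑ i, (p i).1 = ∑ i, α i,
        wickNormSq p * (multiWickCoeff α β p * multiWickCoeff α' β' p) =
      if α = α' ∧ β = β' then ∏ i, (α i)! * (β i)! else 0 := by
  rw [sum_eq_single_of_mem (fun i => (α i, β i)) (by simp [wickBox, hα, hβ])]
  · rw [multiWickCoeff_self, one_mul]
    split_ifs with h
    · rw [← h.1, ← h.2, multiWickCoeff_self, mul_one, wickNormSq]
    · rw [mul_eq_zero]
      right
      by_contra hne
      have hp := eq_of_multiWickCoeff_ne_zero hsum.symm hne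
      simp only [funext_iff, Prod.mk.injEq, forall_and] at hp
      exact h ⟨funext hp.1, funext hp.2⟩
  · intro p hp hne
    have : multiWickCoeff α β p = 0 := by
      by_contra h
      exact hne (eq_of_multiWickCoeff_ne_zero (mem_filter.1 hp).2 h)
    rw [this, zero_mul, mul_zero]

variable {ι ι' : Type*} [Fintype ι] [Fintype ι'] [DecidableEq κ]

variable (ι ι') in
/-- The Gram matrix of the functions `∏ j, z (x.1 j) * ∏ k, conj z (x.2 k)`, indexed by pairs of
words `x`, after projecting them onto the Wick polynomials with exponents in `S`. -/
def wickGram (S : Finset (κ → ℕ × ℕ)) :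
    Matrix ((ι → κ) × (ι' → κ)) ((ι → κ) × (ι' → κ)) ℂ :=
  of fun x y => ((∑ p ∈ S, wickNormSq p *
    (multiWickCoeff (occurrences x.1) (occurrences x.2) p *
      multiWickCoeff (occurrences y.1) (occurrences y.2) p) : ℕ) : ℂ)

theorem posSemidef_wickGram (S : Finset (κ → ℕ × ℕ)) : (wickGram ι ι' S).PosSemidef := by
  let v (p : κ → ℕ × ℕ) (x : (ι → κ) × (ι' → κ)) : ℂ :=
    (multiWickCoeff (occurrences x.1) (occurrences x.2) p : ℂ)
  have hsum : wickGram ι ι' S = ∑ p ∈ S, (wickNormSq p : ℂ) • vecMulVec (v p) (star (v p)) := by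
    ext x y
    simp [wickGram, v, Matrix.sum_apply, vecMulVec_apply]
  rw [hsum]
  exact posSemidef_sum S fun p _ =>
    (posSemidef_vecMulVec_self_star (v p)).smul (Nat.cast_nonneg _)

theorem wickGram_filter_add_wickGram_filter_not (S : Finset (κ → ℕ × ℕ))
    (P : (κ → ℕ × ℕ) → Prop) [DecidablePred P] :
    wickGram ι ι' (S.filter P) + wickGram ι ι' (S.filter fun p => ¬P p) = wickGram ι ι' S := by
  ext x y
  simp only [wickGram, Matrix.add_apply, of_apply, ← Nat.cast_add,
    sum_filter_add_sum_filter_not]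

end WickExpansion

section Moments

open MeasureTheory Set ComplexConjugate
open scoped Nat Real

theorem integral_complex_gaussian_rotate (a b : ℕ) (c : Circle) :
    ∫ z : ℂ, z ^ a * conj z ^ b * Real.exp (-‖z‖ ^ 2) =
      c ^ a * conj (c : ℂ) ^ b * ∫ z : ℂ, z ^ a * conj z ^ b * Real.exp (-‖z‖ ^ 2) := by
  have hrotate := (rotation c).measurePreserving.integral_comp
    (rotation c).toHomeomorph.measurableEmbedding
    (fun z : ℂ => z ^ a * conj z ^ b * (Real.exp (-‖z‖ ^ 2) : ℂ))
  rw [← integral_const_mul]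
  refine hrotate.symm.trans ?_
  congr 1 with z
  simp only [rotation_apply, map_mul, norm_mul, Circle.norm_coe, mul_pow, one_mul]
  ring

theorem integral_complex_gaussian_of_ne {a b : ℕ} (h : a ≠ b) :
    ∫ z : ℂ, z ^ a * conj z ^ b * Real.exp (-‖z‖ ^ 2) = 0 := by
  have hab : (a : ℂ) - b ≠ 0 := sub_ne_zero.2 (Nat.cast_injective.ne h)
  let c : Circle := Circle.exp (π / (a - b))
  have hc : (c : ℂ) ^ a * conj (c : ℂ) ^ b = -1 := by
    rw [← Circle.coe_inv_eq_conj, Circle.coe_inv, Circle.coe_exp, ← Complex.exp_neg,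
      ← Complex.exp_nat_mul, ← Complex.exp_nat_mul, ← Complex.exp_add, ← Complex.exp_pi_mul_I]
    congr 1
    push_cast
    field_simp
    ring
  have hrotate := integral_complex_gaussian_rotate a b c
  rwa [hc, neg_one_mul, self_eq_neg] at hrotate

theorem integral_complex_gaussian_self (a : ℕ) :
    ∫ z : ℂ, z ^ a * conj z ^ a * Real.exp (-‖z‖ ^ 2) = π * a ! := by
  have hpolar := Complex.integral_rpow_mul_exp_neg_rpow (p := 2) (q := 2 * a) one_le_two
    (by linarith [(Nat.cast_nonneg a : (0 : ℝ) ≤ a)])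
  rw [show (2 * (a : ℝ) + 2) / 2 = a + 1 by ring, Real.Gamma_nat_eq_factorial] at hpolar
  have hnorm (z : ℂ) : z ^ a * conj z ^ a * (Real.exp (-‖z‖ ^ 2) : ℂ) =
      ((‖z‖ ^ (2 * (a : ℝ)) * Real.exp (-‖z‖ ^ (2 : ℝ)) : ℝ) : ℂ) := by
    rw [← mul_pow, Complex.mul_conj, Complex.normSq_eq_norm_sq, Real.rpow_mul (norm_nonneg z),
      Real.rpow_two, Real.rpow_natCast]
    push_cast
    rfl
  simp_rw [hnorm]
  rw [integral_complex_ofReal, hpolar]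
  push_cast
  ring

theorem integral_complex_gaussian (a b : ℕ) :
    ∫ z : ℂ, z ^ a * conj z ^ b * Real.exp (-‖z‖ ^ 2) = if a = b then (π * a ! : ℂ) else 0 := by
  split_ifs with h
  · rw [← h, integral_complex_gaussian_self]
  · exact integral_complex_gaussian_of_ne h

variable {ι : Type*} [Fintype ι]

theorem integral_pi_complex_gaussian (α β : ι → ℕ) :
    ∫ z : ι → ℂ, ∏ i, (z i ^ α i * conj (z i) ^ β i * (Real.exp (-‖z i‖ ^ 2) : ℂ)) =
      (if α = β then ∏ i, ((α i)! : ℂ) else 0) * (π : ℂ) ^ Fintype.card ι := by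
  rw [integral_fintype_prod_volume_eq_prod (fun i (z : ℂ) =>
    z ^ α i * conj z ^ β i * (Real.exp (-‖z‖ ^ 2) : ℂ))]
  simp_rw [integral_complex_gaussian, Finset.prod_ite_zero, Finset.mem_univ, true_imp_iff,
    ← funext_iff, Finset.prod_mul_distrib, Finset.prod_const, Finset.card_univ, ite_mul, zero_mul,
    mul_comm]

theorem integral_monomial_mul_gaussian (μ : Measure (EuclideanSpace ℂ ι)) [μ.IsAddHaarMeasure]
    (α β : ι → ℕ) :
    ∫ z, (∏ i, z i ^ α i) * conj (∏ i, z i ^ β i) * (Real.exp (-‖z‖ ^ 2) : ℂ) ∂μ =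
      (if α = β then ∏ i, ((α i)! : ℂ) else 0) * ∫ z, (Real.exp (-‖z‖ ^ 2) : ℂ) ∂μ := by
  let e := (PiLp.continuousLinearEquiv 2 ℝ (fun _ : ι => ℂ)).symm
  let ν : Measure (EuclideanSpace ℂ ι) := (volume : Measure (ι → ℂ)).map e
  have : ν.IsAddHaarMeasure := e.isAddHaarMeasure_map volume
  have hmoment (α β : ι → ℕ) :
      ∫ z, (∏ i, z i ^ α i) * conj (∏ i, z i ^ β i) * (Real.exp (-‖z‖ ^ 2) : ℂ) ∂ν =
        (if α = β then ∏ i, ((α i)! : ℂ) else 0) * (π : ℂ) ^ Fintype.card ι := by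
    rw [← integral_pi_complex_gaussian]
    refine (e.toHomeomorph.measurableEmbedding.integral_map _).trans ?_
    congr 1 with z
    rw [EuclideanSpace.norm_sq_eq, ← Finset.sum_neg_distrib, Real.exp_sum, map_prod,
      Complex.ofReal_prod, ← Finset.prod_mul_distrib, ← Finset.prod_mul_distrib]
    simp only [map_pow]
    rfl
  have hmass : ∫ z, (Real.exp (-‖z‖ ^ 2) : ℂ) ∂ν = (π : ℂ) ^ Fintype.card ι := by
    simpa using hmoment 0 0
  rw [Measure.isAddLeftInvariant_eq_smul μ ν, integral_smul_nnreal_measure,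
    integral_smul_nnreal_measure, hmoment, hmass, mul_smul_comm]

theorem integral_volumeIoiPow_pow_mul_gaussian (n k : ℕ) :
    ∫ r : Ioi (0 : ℝ), ((r : ℝ) : ℂ) ^ k * Real.exp (-(r : ℝ) ^ 2) ∂(Measure.volumeIoiPow n) =
      (Real.Gamma ((n + 1 + k : ℝ) / 2) / 2 : ℝ) := by
  have hGamma := integral_rpow_mul_exp_neg_rpow (p := 2) (q := (n + k : ℕ)) two_pos
    (by linarith [(Nat.cast_nonneg (n + k) : (0 : ℝ) ≤ (n + k : ℕ))])
  have hsmul (r : ℝ) (hr : r ∈ Ioi (0 : ℝ)) :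
      Real.toNNReal (r ^ n) • ((r : ℂ) ^ k * (Real.exp (-r ^ 2) : ℂ)) =
        ((r ^ ((n + k : ℕ) : ℝ) * Real.exp (-r ^ (2 : ℝ)) : ℝ) : ℂ) := by
    rw [NNReal.smul_def, Real.coe_toNNReal _ (pow_nonneg (le_of_lt hr) _), Real.rpow_natCast,
      Real.rpow_two, pow_add, Complex.real_smul]
    push_cast
    ring
  simp only [Measure.volumeIoiPow, ENNReal.ofReal]
  rw [integral_withDensity_eq_integral_smul
      ((measurable_subtype_coe.pow_const _).real_toNNReal),
    integral_subtype_comap measurableSet_Ioi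
      fun r : ℝ ↦ Real.toNNReal (r ^ n) • ((r : ℂ) ^ k * (Real.exp (-r ^ 2) : ℂ)),
    setIntegral_congr_fun measurableSet_Ioi hsmul, integral_complex_ofReal, hGamma]
  push_cast
  ring_nf

theorem integral_homogeneous_mul_gaussian {E : Type*} [NormedAddCommGroup E] [NormedSpace ℝ E]
    [FiniteDimensional ℝ E] [Nontrivial E] [MeasurableSpace E] [BorelSpace E] (μ : Measure E)
    [μ.IsAddHaarMeasure] (f : E → ℂ) (k : ℕ)
    (hf : ∀ (r : ℝ) (x : E), 0 < r → f (r • x) = (r : ℂ) ^ k * f x) :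
    ∫ x, f x * Real.exp (-‖x‖ ^ 2) ∂μ =
      (∫ x : Metric.sphere (0 : E) 1, f x ∂μ.toSphere) *
        (Real.Gamma ((Module.finrank ℝ E + k : ℝ) / 2) / 2 : ℝ) := by
  calc ∫ x, f x * Real.exp (-‖x‖ ^ 2) ∂μ
      = ∫ x : ({(0)}ᶜ : Set E), f x.1 * Real.exp (-‖x.1‖ ^ 2) ∂(μ.comap (↑)) := by
        rw [integral_subtype_comap (measurableSet_singleton _).compl
          fun x ↦ f x * (Real.exp (-‖x‖ ^ 2) : ℂ), restrict_compl_singleton]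
    _ = ∫ y : Metric.sphere (0 : E) 1 × Ioi (0 : ℝ),
          f y.1 * (((y.2 : ℝ) : ℂ) ^ k * Real.exp (-(y.2 : ℝ) ^ 2))
          ∂μ.toSphere.prod (.volumeIoiPow (Module.finrank ℝ E - 1)) := by
        rw [← μ.measurePreserving_homeomorphUnitSphereProd.integral_comp
          (Homeomorph.measurableEmbedding _)]
        congr 1 with x
        have hx : 0 < ‖x.1‖ := norm_pos_iff.2 x.2
        have hfx : f x.1 = (‖x.1‖ : ℂ) ^ k * f (‖x.1‖⁻¹ • x.1) := by
          rw [← hf _ _ hx, smul_inv_smul₀ hx.ne']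
        simp only [homeomorphUnitSphereProd_apply_snd_coe, homeomorphUnitSphereProd_apply_fst_coe]
        rw [hfx]
        ring
    _ = _ := by
        rw [integral_prod_mul (fun y : Metric.sphere (0 : E) 1 => f y)
          (fun r : Ioi (0 : ℝ) => ((r : ℝ) : ℂ) ^ k * (Real.exp (-(r : ℝ) ^ 2) : ℂ)),
          integral_volumeIoiPow_pow_mul_gaussian, Nat.cast_pred Module.finrank_pos, sub_add_cancel]

theorem ascFactorial_pos_of_pos {d : ℕ} (hd : 0 < d) (m : ℕ) : 0 < d.ascFactorial m :=
  (pow_pos hd m).trans_le (Nat.pow_succ_le_ascFactorial d m)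

theorem gamma_natCast_add_natCast {d : ℕ} (hd : 0 < d) (m : ℕ) :
    Real.Gamma (d + m) = d.ascFactorial m * Real.Gamma d := by
  obtain ⟨d, rfl⟩ := Nat.exists_eq_succ_of_ne_zero hd.ne'
  have hsum : ((d.succ : ℕ) + m : ℝ) = (d + m : ℕ) + 1 := by
    push_cast
    ring
  rw [hsum, Real.Gamma_nat_eq_factorial, Nat.cast_succ, Real.Gamma_nat_eq_factorial,
    ← Nat.factorial_mul_ascFactorial, Nat.cast_mul, mul_comm]

theorem integral_toSphere_monomial [Nonempty ι] (μ : Measure (EuclideanSpace ℂ ι))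
    [μ.IsAddHaarMeasure] (α β : ι → ℕ) :
    ∫ z : Metric.sphere (0 : EuclideanSpace ℂ ι) 1,
        (∏ i, z.1 i ^ α i) * conj (∏ i, z.1 i ^ β i) ∂μ.toSphere =
      (if α = β then (∏ i, ((α i)! : ℂ)) / (Fintype.card ι).ascFactorial (∑ i, α i) else 0) *
        μ.toSphere.real univ := by
  have hcard : 0 < Fintype.card ι := Fintype.card_pos
  have hfinrank : (Module.finrank ℝ (EuclideanSpace ℂ ι) : ℝ) = 2 * Fintype.card ι := by
    rw [← Module.finrank_mul_finrank ℝ ℂ, Complex.finrank_real_complex, finrank_euclideanSpace]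
    push_cast
    rfl
  have hmonomial := integral_homogeneous_mul_gaussian μ
    (fun z => (∏ i, z i ^ α i) * conj (∏ i, z i ^ β i)) (∑ i, α i + ∑ i, β i) (by
      intro r z _
      simp only [PiLp.smul_apply, Complex.real_smul, mul_pow, Finset.prod_mul_distrib, map_mul,
        Finset.prod_pow_eq_pow_sum, map_pow, Complex.conj_ofReal]
      ring)
  have hone := integral_homogeneous_mul_gaussian μ (fun _ => 1) 0 (by simp)
  simp only [one_mul, hfinrank, Nat.cast_zero, add_zero, integral_const, Complex.real_smul,
    mul_one, mul_div_cancel_left₀ (Fintype.card ι : ℝ) two_ne_zero] at hone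
  rw [integral_monomial_mul_gaussian, hone, hfinrank] at hmonomial
  have hasc : ((Fintype.card ι).ascFactorial (∑ i, α i) : ℂ) ≠ 0 :=
    Nat.cast_ne_zero.2 (ascFactorial_pos_of_pos hcard _).ne'
  refine mul_right_cancel₀ (b := ((Real.Gamma ((2 * Fintype.card ι +
    (∑ i, α i + ∑ i, β i : ℕ)) / 2) / 2 : ℝ) : ℂ)) ?_ (hmonomial.symm.trans ?_)
  · exact Complex.ofReal_ne_zero.2 (half_pos (Real.Gamma_pos_of_pos (by positivity))).ne'
  split_ifs with h
  · subst h
    rw [← two_mul, Nat.cast_mul, Nat.cast_two, ← mul_add, mul_div_cancel_left₀ _ two_ne_zero,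
      gamma_natCast_add_natCast hcard]
    push_cast
    field_simp
  · simp only [zero_mul]

theorem average_toSphere_monomial [Nonempty ι] (μ : Measure (EuclideanSpace ℂ ι))
    [μ.IsAddHaarMeasure] (α β : ι → ℕ) :
    ⨍ z : Metric.sphere (0 : EuclideanSpace ℂ ι) 1,
        (∏ i, z.1 i ^ α i) * conj (∏ i, z.1 i ^ β i) ∂μ.toSphere =
      if α = β then (∏ i, ((α i)! : ℂ)) / (Fintype.card ι).ascFactorial (∑ i, α i) else 0 := by
  have : NeZero μ.toSphere := ⟨μ.toSphere_ne_zero⟩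
  have hmass : (μ.toSphere.real univ : ℂ) ≠ 0 :=
    Complex.ofReal_ne_zero.2 measureReal_univ_ne_zero
  rw [average_eq, Complex.real_smul, integral_toSphere_monomial, mul_comm, Complex.ofReal_inv,
    mul_inv_cancel_right₀ hmass]

end Moments

section HaarStates

open MeasureTheory Matrix ComplexConjugate
open scoped Nat Kronecker ComplexOrder

theorem integral_haarState_monomial {n : ℕ} (α β : Bits n → ℕ) :
    ∫ ψ, (∏ i, ψ.1 i ^ α i) * conj (∏ i, ψ.1 i ^ β i) ∂haarState n =
      if α = β then (∏ i, ((α i)! : ℂ)) / (2 ^ n).ascFactorial (∑ i, α i) else 0 := by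
  have hcard : Fintype.card (Bits n) = 2 ^ n := by simp
  have hmoment := average_toSphere_monomial (volume : Measure (EuclideanSpace ℂ (Bits n))) α β
  rwa [hcard, average, ← haarState] at hmoment

theorem tensorPow_ketbra_apply {n t : ℕ} (ψ : PureState n) (x y : Reg n t) :
    tensorPow t (ketbra ψ) x y =
      (∏ i, ψ.1 i ^ occurrences x i) * conj (∏ i, ψ.1 i ^ occurrences y i) := by
  simp only [← prod_comp_eq_prod_pow_occurrences, tensorPow, ketbra, of_apply, vecMulVec_apply,
    Pi.star_apply, Finset.prod_mul_distrib, map_prod, starRingEnd_apply]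

theorem matrixExp_tensorPow_ketbra_apply {n t : ℕ} (x y : Reg n t) :
    matrixExp (haarState n) (fun ψ => tensorPow t (ketbra ψ)) x y =
      if occurrences x = occurrences y then
        (∏ i, ((occurrences x i)! : ℂ)) / (2 ^ n).ascFactorial t else 0 := by
  simp only [matrixExp, of_apply, tensorPow_ketbra_apply, integral_haarState_monomial,
    sum_occurrences, Fintype.card_fin]

theorem identicalHaar_apply {n t : ℕ} (x y : Reg n t × Reg n t) :
    identicalHaar n t x y =
      if occurrences x.1 + occurrences x.2 = occurrences y.1 + occurrences y.2 then
        (∏ i, ((occurrences x.1 i + occurrences x.2 i)! : ℂ)) / (2 ^ n).ascFactorial (2 * t)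
      else 0 := by
  have hmonomial (ψ : PureState n) :
      (tensorPow t (ketbra ψ) ⊗ₖ tensorPow t (ketbra ψ)) x y =
        (∏ i, ψ.1 i ^ (occurrences x.1 + occurrences x.2) i) *
          conj (∏ i, ψ.1 i ^ (occurrences y.1 + occurrences y.2) i) := by
    simp only [kroneckerMap_apply, tensorPow_ketbra_apply, Pi.add_apply, pow_add,
      Finset.prod_mul_distrib, map_mul]
    ring
  simp only [identicalHaar, matrixExp, of_apply, hmonomial, integral_haarState_monomial,
    Pi.add_apply, Finset.sum_add_distrib, sum_occurrences, Fintype.card_fin, two_mul]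
  rfl

theorem partialTranspose_identicalHaar (n t : ℕ) :
    partialTranspose (identicalHaar n t) =
      ((2 ^ n).ascFactorial (2 * t) : ℝ)⁻¹ • wickGram (Fin t) (Fin t) (wickBox (Bits n) t) := by
  have hocc (x : Reg n t) (i : Bits n) : occurrences x i ≤ t := by
    simpa using occurrences_le_card x i
  ext x y
  rw [partialTranspose_apply, identicalHaar_apply, Matrix.smul_apply, wickGram, of_apply,
    sum_multiWickCoeff_mul_multiWickCoeff (hocc _) (hocc _), Complex.real_smul]
  push_cast
  rw [mul_ite, mul_zero, div_eq_inv_mul]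

theorem partialTranspose_independentHaar (n t : ℕ) :
    partialTranspose (independentHaar n t) =
      (((2 ^ n).ascFactorial t : ℝ) ^ 2)⁻¹ •
        wickGram (Fin t) (Fin t) {p ∈ wickBox (Bits n) t | ∑ i, (p i).1 = t} := by
  have hocc (x : Reg n t) (i : Bits n) : occurrences x i ≤ t := by
    simpa using occurrences_le_card x i
  have hsum (x : Reg n t) : ∑ i, occurrences x i = t := by simpa using sum_occurrences x
  ext x y
  have htop := sum_topDegree_multiWickCoeff_mul_multiWickCoeff (hocc x.1) (hocc x.2)
    (β' := occurrences y.2) ((hsum y.1).trans (hsum x.1).symm)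
  rw [hsum] at htop
  rw [partialTranspose_apply, Matrix.smul_apply, wickGram, of_apply, htop, independentHaar,
    kroneckerMap_apply, matrixExp_tensorPow_ketbra_apply, matrixExp_tensorPow_ketbra_apply,
    Complex.real_smul]
  by_cases hA : occurrences x.1 = occurrences y.1 <;>
    by_cases hB : occurrences x.2 = occurrences y.2
  · simp only [hA, hB, and_self, if_true]
    push_cast
    rw [Finset.prod_mul_distrib]
    ring
  all_goals simp [hA, hB, eq_comm]

theorem continuous_tensorPow_ketbra {n t : ℕ} (x y : Reg n t) :
    Continuous fun ψ : PureState n => tensorPow t (ketbra ψ) x y := by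
  simp only [tensorPow, ketbra, vecMulVec_apply, of_apply, Pi.star_apply]
  fun_prop

theorem integrable_haarState {n : ℕ} {f : PureState n → ℂ} (hf : Continuous f) :
    Integrable f (haarState n) :=
  hf.integrable_of_hasCompactSupport (HasCompactSupport.of_compactSpace f)

theorem trace_matrixExp {Ω κ : Type} [MeasurableSpace Ω] [Fintype κ] {μ : Measure Ω}
    {F : Ω → Matrix κ κ ℂ} (hF : ∀ x, Integrable (fun ω => F ω x x) μ) :
    (matrixExp μ F).trace = ∫ ω, (F ω).trace ∂μ :=
  (integral_finsetSum _ fun x _ => hF x).symm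

theorem trace_ketbra {n : ℕ} (ψ : PureState n) : (ketbra ψ).trace = 1 := by
  rw [ketbra, trace_vecMulVec, ← EuclideanSpace.inner_eq_star_dotProduct ψ.1 ψ.1,
    inner_self_eq_norm_sq_to_K, norm_eq_of_mem_sphere, RCLike.ofReal_one, one_pow]

theorem trace_tensorPow {κ : Type} [Fintype κ] (t : ℕ) (M : Matrix κ κ ℂ) :
    (tensorPow t M).trace = M.trace ^ t := by
  classical
  simp only [trace, diag_apply, tensorPow, of_apply]
  rw [Finset.sum_pow', Fintype.piFinset_univ]

theorem trace_identicalHaar (n t : ℕ) : (identicalHaar n t).trace = 1 := by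
  rw [identicalHaar, trace_matrixExp fun x => integrable_haarState
    ((continuous_tensorPow_ketbra _ _).mul (continuous_tensorPow_ketbra _ _))]
  simp [trace_kronecker, trace_tensorPow, trace_ketbra]

theorem trace_independentHaar (n t : ℕ) : (independentHaar n t).trace = 1 := by
  rw [independentHaar, trace_kronecker,
    trace_matrixExp fun x => integrable_haarState (continuous_tensorPow_ketbra _ _)]
  simp [trace_tensorPow, trace_ketbra]

theorem one_sub_mul_ascFactorial_add_le {d : ℕ} (hd : 0 < d) (s t : ℕ) :
    (1 - s * t / d : ℝ) * (d + s).ascFactorial t ≤ d.ascFactorial t := by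
  induction t with
  | zero => simp
  | succ t ih =>
    have hfactor : (1 - s * (t + 1 : ℕ) / d : ℝ) * (d + s + t) ≤ (1 - s * t / d) * (d + t) := by
      have hdiff : (1 - s * t / d : ℝ) * (d + t) - (1 - s * (t + 1 : ℕ) / d) * (d + s + t) =
          s * t / d * s + s ^ 2 / d + s * t / d := by
        push_cast
        field_simp
        ring
      have : (0 : ℝ) ≤ s * t / d * s + s ^ 2 / d + s * t / d := by positivity
      linarith
    calc (1 - s * (t + 1 : ℕ) / d : ℝ) * (d + s).ascFactorial (t + 1)
        = (1 - s * (t + 1 : ℕ) / d) * (d + s + t) * (d + s).ascFactorial t := by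
          rw [Nat.ascFactorial_succ]
          push_cast
          ring
      _ ≤ (1 - s * t / d) * (d + t) * (d + s).ascFactorial t := by gcongr
      _ = (d + t) * ((1 - s * t / d) * (d + s).ascFactorial t) := by ring
      _ ≤ (d + t) * d.ascFactorial t := by gcongr
      _ = d.ascFactorial (t + 1) := by
          rw [Nat.ascFactorial_succ]
          push_cast
          ring

theorem one_sub_mul_inv_ascFactorial_sq_le {d : ℕ} (hd : 0 < d) (t : ℕ) :
    (1 - t ^ 2 / d : ℝ) * ((d.ascFactorial t : ℝ) ^ 2)⁻¹ ≤ (d.ascFactorial (2 * t) : ℝ)⁻¹ := by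
  have hpos : (0 : ℝ) < d.ascFactorial t := Nat.cast_pos.2 (ascFactorial_pos_of_pos hd t)
  have hpos' : (0 : ℝ) < (d + t).ascFactorial t :=
    Nat.cast_pos.2 (ascFactorial_pos_of_pos (Nat.add_pos_left hd t) t)
  have hle := one_sub_mul_ascFactorial_add_le hd t t
  rw [two_mul, ← Nat.ascFactorial_mul_ascFactorial, Nat.cast_mul, ← div_eq_mul_inv, ← one_div,
    div_le_div_iff₀ (by positivity) (by positivity), one_mul, sq, sq]
  nlinarith

theorem isPPT_independentHaar (n t : ℕ) : IsPPT (independentHaar n t) := by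
  rw [IsPPT, partialTranspose_independentHaar]
  exact (posSemidef_wickGram _).smul (by positivity)

theorem isPPT_identicalHaar_sub (n t : ℕ) :
    IsPPT (identicalHaar n t - (1 - (t : ℝ) ^ 2 / 2 ^ n) • independentHaar n t) := by
  let ε : ℝ := t ^ 2 / 2 ^ n
  let w : ℝ := ((2 ^ n).ascFactorial (2 * t) : ℝ)⁻¹
  let v : ℝ := (((2 ^ n).ascFactorial t : ℝ) ^ 2)⁻¹
  let P (p : Bits n → ℕ × ℕ) : Prop := ∑ i, (p i).1 = t
  let top := wickGram (Fin t) (Fin t) ((wickBox (Bits n) t).filter P)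
  let lower := wickGram (Fin t) (Fin t) ((wickBox (Bits n) t).filter fun p => ¬P p)
  have hsplit : partialTranspose
      (identicalHaar n t - (1 - (t : ℝ) ^ 2 / 2 ^ n) • independentHaar n t) =
        (w - (1 - ε) * v) • top + w • lower := by
    rw [partialTranspose_sub_smul, partialTranspose_identicalHaar,
      partialTranspose_independentHaar, ← wickGram_filter_add_wickGram_filter_not _ P]
    module
  have hweight : (1 - ε) * v ≤ w := by
    simpa using one_sub_mul_inv_ascFactorial_sq_le (Nat.two_pow_pos n) t
  rw [IsPPT, hsplit]
  exact ((posSemidef_wickGram _).smul (sub_nonneg.2 hweight)).add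
    ((posSemidef_wickGram _).smul (by positivity))

theorem loccIndistinguishable_identicalHaar_independentHaar (n t : ℕ) :
    LOCCIndistinguishable ((t : ℝ) ^ 2 / 2 ^ n) (identicalHaar n t) (independentHaar n t) :=
  .of_isPPT (by positivity) (trace_identicalHaar n t) (trace_independentHaar n t)
    (isPPT_independentHaar n t) (isPPT_identicalHaar_sub n t)

end HaarStates

end LOCCHaar

end

theorem mainTheorem1 :
    ∃ C : ℝ, 0 < C ∧ ∀ n t : ℕ,
      LOCCHaar.LOCCIndistinguishable (C * ((t : ℝ) ^ 2 / (2 : ℝ) ^ n))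
        (LOCCHaar.identicalHaar n t) (LOCCHaar.independentHaar n t) := by
  refine ⟨1, one_pos, fun n t => ?_⟩
  rw [one_mul]
  exact LOCCHaar.loccIndistinguishable_identicalHaar_independentHaar n t
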